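/- Let $G$ be a compact topological group, let $\mu$ be its Haar measure, normalized so that $\mu(G)=1$, and let $X$ be the set of conjugacy classes of $G$ with the quotient topology, $\pi\colon G\to X$ being the natural projection. Let $C(X)$ be the space of continuous functions $X\to\mathbb{C}$, and define the push-forward of $\mu$ to $X$ as the linear form $$\mu(f):=\int_G f(\pi(g))\,d\mu(g),\qquad f\in C(X).$$ Let $(x_n)_{n\ge 1}$ be a sequence of elements of $X$. It is called $\mu$-equidistributed if $$\lim_{n\to\infty}\frac1n\sum_{i=1}^n f(x_i)=\mu(f)\qquad\text{for every } f\in C(X).$$ Then $(x_n)_{n\ge1}$ is $\mu$-equidistributed if and only if $$\lim_{n\to\infty}\frac1n\sum_{i=1}^n\chi(x_i)=0$$ for every nontrivial irreducible character $\chi$ of $G$. Here an irreducible character is the function $X\to\mathbb{C}$ induced by $g\mapsto\operatorname{tr}\rho(g)$, where $\rho$ is a continuous irreducible representation of $G$ on a finite-dimensional complex vector space, and $\chi$ is nontrivial if it is not the constant function $1$. -/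

import Mathlib

open Filter Topology MeasureTheory

/-- The set of conjugacy classes of a topological group carries the quotient topology. -/
instance ConjClasses.instTopologicalSpaceQuotient {G : Type*} [Group G] [TopologicalSpace G] :
    TopologicalSpace (ConjClasses G) :=
  inferInstanceAs (TopologicalSpace (Quotient (IsConj.setoid G)))

instance ConjClasses.instCompactSpaceQuotient {G : Type*} [Group G] [TopologicalSpace G]
    [CompactSpace G] : CompactSpace (ConjClasses G) :=
  inferInstanceAs (CompactSpace (Quotient (IsConj.setoid G)))

theorem ConjClasses.continuous_mk_quotient {G : Type*} [Group G] [TopologicalSpace G] :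
    Continuous (ConjClasses.mk : G → ConjClasses G) :=
  continuous_quotient_mk'

/-- The sequence `x 1, x 2, …` of points of the compact space `X` is equidistributed with respect
to the continuous linear form `μ` on `C(X)`: for every continuous `f : X → ℂ` the averages
`(1 / n) ∑_{i = 1}^n f (x i)` tend to `μ f`. The value `x 0` plays no role. -/
def IsEquidistributed {X : Type*} [TopologicalSpace X] [CompactSpace X]
    (μ : C(X, ℂ) →L[ℂ] ℂ) (x : ℕ → X) : Prop :=
  ∀ f : C(X, ℂ),
    Tendsto (fun n : ℕ => (1 / (n : ℂ)) * ∑ i ∈ Finset.Icc 1 n, f (x i)) atTop (𝓝 (μ f))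

theorem integrable_comp_conjClasses_mk {G : Type*} [Group G] [TopologicalSpace G] [CompactSpace G]
    [MeasurableSpace G] [BorelSpace G] (μ : Measure G) [IsFiniteMeasure μ]
    (f : C(ConjClasses G, ℂ)) : Integrable (fun g : G => f (ConjClasses.mk g)) μ :=
  Integrable.of_bound
    (f.continuous.comp ConjClasses.continuous_mk_quotient).measurable.aestronglyMeasurable
    ‖f‖ (Eventually.of_forall fun _ => f.norm_coe_le_norm _)

/-- The push-forward to the space of conjugacy classes of the Radon measure on `G` given by the
finite Borel measure `μ`: the continuous linear form `f ↦ μ (f ∘ π)`, where `π` sends an element of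
`G` to its conjugacy class. -/
noncomputable def pushforwardConjClasses {G : Type*} [Group G] [TopologicalSpace G]
    [CompactSpace G] [MeasurableSpace G] [BorelSpace G] (μ : Measure G) [IsFiniteMeasure μ] :
    C(ConjClasses G, ℂ) →L[ℂ] ℂ :=
  LinearMap.mkContinuous
    { toFun := fun f => ∫ g, f (ConjClasses.mk g) ∂μ
      map_add' := fun f h =>
        integral_add (integrable_comp_conjClasses_mk μ f) (integrable_comp_conjClasses_mk μ h)
      map_smul' := fun c f => integral_const_mul c fun g => f (ConjClasses.mk g) }
    (μ.real Set.univ)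
    (fun f => by
      rw [mul_comm]
      exact norm_integral_le_of_norm_le_const
        (Eventually.of_forall fun _ => f.norm_coe_le_norm _))

/-- The character of a representation, as a function on the set of conjugacy classes. -/
noncomputable def classCharacter {G V : Type*} [Group G] [AddCommGroup V] [Module ℂ V]
    (ρ : Representation ℂ G V) : ConjClasses G → ℂ :=
  Quotient.lift ρ.character (by
    intro a b h
    obtain ⟨c, rfl⟩ := isConj_iff.1 h
    rw [ρ.char_mul_comm, inv_mul_cancel_left])

/-- `χ` is an irreducible character of the topological group `G`, seen as a function on conjugacy
classes: the character of a continuous irreducible representation of `G` on a finite-dimensional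
complex vector space (which may be taken to be some `ℂⁿ`). The zero representation is not
irreducible. -/
def IsIrreducibleCharacter {G : Type*} [Group G] [TopologicalSpace G]
    (χ : ConjClasses G → ℂ) : Prop :=
  ∃ (n : ℕ) (ρ : Representation ℂ G (Fin n → ℂ)),
    Continuous (fun p : G × (Fin n → ℂ) => ρ p.1 p.2) ∧ ρ.IsIrreducible ∧ classCharacter ρ = χ

/-! Averages along the sequence and integration against `μ` are linear and bounded in sup norm, so
equidistribution need only be tested on a family with dense span in `C(X)`. Irreducible characters
form such a family: the trivial one has average and integral `1`, and the others have integral `0`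
(`integral_character_eq_zero`).

Density (`exists_mem_characterSpan_norm_sub_le`) is Peter–Weyl followed by averaging. Given `F` in
`C(G)`, convolution with a symmetric bump, supported where right translation barely moves `F`, is a
compact symmetric operator commuting with left translations. Its eigenspaces for nonzero eigenvalues
are finite-dimensional left-invariant spaces of continuous functions, whose sums approximate `F`
uniformly. Conjugation averaging fixes class functions, and turns functions in such spaces, up to
inverting the argument, into combinations of irreducible characters. As `μ` need not be regular, the
Hilbert space is the closure of `C(G)` in `L²`. -/

/-! ### Traces -/

theorem LinearMap.trace_eq_trace_restrict_add_trace_mapQ {K V : Type*} [Field K] [AddCommGroup V]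
    [Module K V] [Module.Finite K V] (f : V →ₗ[K] V) (W : Submodule K V) (hf : W ≤ W.comap f) :
    LinearMap.trace K V f
      = LinearMap.trace K W (f.restrict hf) + LinearMap.trace K (V ⧸ W) (W.mapQ W f hf) := by
  obtain ⟨s, hs⟩ := W.mkQ.exists_rightInverse_of_surjective
    (LinearMap.range_eq_top.2 W.mkQ_surjective)
  have hr : ∀ v, (LinearMap.id - s ∘ₗ W.mkQ : V →ₗ[K] V) v ∈ W := by
    intro v
    suffices h : W.mkQ ((LinearMap.id - s ∘ₗ W.mkQ : V →ₗ[K] V) v) = 0 by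
      rwa [← LinearMap.mem_ker, Submodule.ker_mkQ] at h
    have := LinearMap.congr_fun hs (W.mkQ v)
    simp only [LinearMap.comp_apply, LinearMap.id_apply] at this
    simp only [LinearMap.sub_apply, LinearMap.comp_apply, LinearMap.id_apply, map_sub, this,
      sub_self]
  let r : V →ₗ[K] W := LinearMap.codRestrict W (LinearMap.id - s ∘ₗ W.mkQ) hr
  -- One summand factors through `W`, the other through `V ⧸ W`; cyclicity of the trace then yields
  -- the two induced maps.
  have hdec : f = (f ∘ₗ W.subtype) ∘ₗ r + (f ∘ₗ s) ∘ₗ W.mkQ := by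
    ext v
    simp [r]
  have h1 : r ∘ₗ (f ∘ₗ W.subtype) = f.restrict hf := by
    ext w
    have : W.mkQ (f w) = 0 := by simpa using hf w.2
    simp only [r, LinearMap.comp_apply, LinearMap.codRestrict_apply, LinearMap.sub_apply,
      Submodule.subtype_apply, LinearMap.id_apply, this, map_zero, sub_zero,
      LinearMap.restrict_apply]
  have h2 : W.mkQ ∘ₗ (f ∘ₗ s) = W.mapQ W f hf := by
    rw [← LinearMap.comp_assoc, ← Submodule.mapQ_mkQ W W f (h := hf),
      LinearMap.comp_assoc, hs, LinearMap.comp_id]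
  conv_lhs => rw [hdec]
  rw [map_add, LinearMap.trace_comp_comm', LinearMap.trace_comp_comm' _ (f ∘ₗ s), h1, h2]

theorem Module.Basis.trace_eq_sum_coord {ι K V : Type*} [Fintype ι] [Field K] [AddCommGroup V]
    [Module K V] (b : Module.Basis ι K V) (f : V →ₗ[K] V) :
    LinearMap.trace K V f = ∑ i, b.coord i (f (b i)) := by
  classical
  simp only [LinearMap.trace_eq_matrix_trace K b, Matrix.trace, Matrix.diag,
    LinearMap.toMatrix_apply, Module.Basis.coord_apply]

/-! ### Representations and the span of characters -/

namespace Representation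

theorem isIrreducible_iff_forall_submodule {G k V : Type*} [Monoid G] [Field k] [AddCommGroup V]
    [Module k V] {ρ : Representation k G V} :
    ρ.IsIrreducible ↔ Nontrivial V ∧
      ∀ U : Submodule k V, (∀ g, ∀ v ∈ U, ρ g v ∈ U) → U = ⊥ ∨ U = ⊤ := by
  constructor
  · intro h
    refine ⟨?_, fun U hU => ?_⟩
    · by_contra hV
      rw [not_nontrivial_iff_subsingleton] at hV
      exact bot_ne_top (α := Subrepresentation ρ)
        (Subrepresentation.toSubmodule_injective (Subsingleton.elim _ _))
    · rcases eq_bot_or_eq_top (⟨U, fun g v hv => hU g v hv⟩ : Subrepresentation ρ) with h | h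
      · exact Or.inl (congrArg Subrepresentation.toSubmodule h)
      · exact Or.inr (congrArg Subrepresentation.toSubmodule h)
  · rintro ⟨hV, h⟩
    refine { exists_pair_ne := ⟨⊥, ⊤, fun he => ?_⟩, eq_bot_or_eq_top := fun U => ?_ }
    · exact bot_ne_top (congrArg Subrepresentation.toSubmodule he)
    · rcases h U.toSubmodule U.apply_mem_toSubmodule with h | h
      · exact Or.inl (Subrepresentation.toSubmodule_injective h)
      · exact Or.inr (Subrepresentation.toSubmodule_injective h)

/-- All matrix coefficients of the representation are continuous. -/
def ContinuousCoeff {G V : Type*} [Group G] [TopologicalSpace G] [AddCommGroup V] [Module ℂ V]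
    (ρ : Representation ℂ G V) : Prop :=
  ∀ (v : V) (φ : V →ₗ[ℂ] ℂ), Continuous fun g => φ (ρ g v)

variable {G V : Type*} [Group G] [TopologicalSpace G] [AddCommGroup V] [Module ℂ V]

theorem ContinuousCoeff.continuous_character [Module.Finite ℂ V] {ρ : Representation ℂ G V}
    (hρ : ρ.ContinuousCoeff) : Continuous ρ.character := by
  have b := Module.finBasis ℂ V
  have : ρ.character = fun g => ∑ i, b.coord i (ρ g (b i)) :=
    funext fun g => b.trace_eq_sum_coord (ρ g)
  rw [this]
  exact continuous_finsetSum _ fun i _ => hρ _ _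

theorem continuousCoeff_of_continuous {n : ℕ} {ρ : Representation ℂ G (Fin n → ℂ)}
    (h : Continuous fun p : G × (Fin n → ℂ) => ρ p.1 p.2) : ρ.ContinuousCoeff := fun _ φ =>
  (LinearMap.continuous_of_finiteDimensional φ).comp
    (h.comp (Continuous.prodMk continuous_id continuous_const))

theorem ContinuousCoeff.continuous {n : ℕ} {ρ : Representation ℂ G (Fin n → ℂ)}
    (hρ : ρ.ContinuousCoeff) : Continuous fun p : G × (Fin n → ℂ) => ρ p.1 p.2 := by
  refine continuous_pi fun i => ?_
  have : (fun p : G × (Fin n → ℂ) => ρ p.1 p.2 i) = fun p : G × (Fin n → ℂ) =>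
      ∑ j, p.2 j * ρ p.1 (Pi.single j 1) i := by
    ext p
    conv_lhs => rw [pi_eq_sum_univ' p.2]
    simp
  rw [this]
  refine continuous_finsetSum _ fun j _ => ((continuous_apply j).comp continuous_snd).mul ?_
  exact (hρ (Pi.single j 1) (LinearMap.proj i)).comp continuous_fst

/-- The span of the irreducible characters of a topological group, in the space of functions on
the set of conjugacy classes. -/
def characterSpan (G : Type*) [Group G] [TopologicalSpace G] : Submodule ℂ (ConjClasses G → ℂ) :=
  Submodule.span ℂ {χ | IsIrreducibleCharacter χ}

theorem exists_isIrreducibleCharacter [Module.Finite ℂ V] {ρ : Representation ℂ G V}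
    (hρ : ρ.ContinuousCoeff) (hirr : ρ.IsIrreducible) :
    ∃ χ : ConjClasses G → ℂ, IsIrreducibleCharacter χ ∧
      ∀ g, χ (ConjClasses.mk g) = ρ.character g := by
  let e : V ≃ₗ[ℂ] (Fin (Module.finrank ℂ V) → ℂ) := (Module.finBasis ℂ V).equivFun
  let σ : Representation ℂ G (Fin (Module.finrank ℂ V) → ℂ) :=
    { toFun := fun g => e.conj (ρ g)
      map_one' := by ext; simp [LinearEquiv.conj_apply]
      map_mul' := fun a b => by ext; simp [LinearEquiv.conj_apply] }
  have hσ : ∀ g v, σ g (e v) = e (ρ g v) := fun g v => by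
    change e.conj (ρ g) (e v) = _
    simp [LinearEquiv.conj_apply]
  have hcont : σ.ContinuousCoeff := fun v φ => by
    obtain ⟨v, rfl⟩ := e.surjective v
    simp only [hσ]
    exact hρ v (φ ∘ₗ e.toLinearMap)
  refine ⟨classCharacter σ, ⟨_, σ, hcont.continuous, ?_, rfl⟩, fun g => ?_⟩
  · rw [isIrreducible_iff_forall_submodule] at hirr ⊢
    obtain ⟨hV, hU⟩ := hirr
    refine ⟨e.symm.toEquiv.nontrivial, fun U hUσ => ?_⟩
    have hm : (U.comap e.toLinearMap).map e.toLinearMap = U :=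
      Submodule.map_comap_eq_of_surjective e.surjective U
    rcases hU (U.comap e.toLinearMap) (fun g v hv => by
      have := hUσ g (e v) hv
      rwa [hσ] at this) with h | h
    · left; rw [← hm, h, Submodule.map_bot]
    · right; rw [← hm, h, Submodule.map_top, LinearMap.range_eq_top]; exact e.surjective
  · change LinearMap.trace ℂ _ (e.conj (ρ g)) = _
    rw [LinearMap.trace_conj']; rfl

/-- Induction on dimension. The trace is additive along a proper nonzero subspace stable under `ρ`
and `A`. If there is none, an eigenspace of `A` is everything, so `A` is scalar and `ρ` irreducible.
Complete reducibility is not needed. -/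
theorem exists_mem_characterSpan_trace_comp [Module.Finite ℂ V] {ρ : Representation ℂ G V}
    (hρ : ρ.ContinuousCoeff) {A : V →ₗ[ℂ] V} (hA : ∀ g, A ∘ₗ ρ g = ρ g ∘ₗ A) :
    ∃ k ∈ characterSpan G, ∀ g, k (ConjClasses.mk g) = LinearMap.trace ℂ V (A ∘ₗ ρ g) := by
  induction hn : Module.finrank ℂ V using Nat.strong_induction_on generalizing V with
  | _ n ih =>
  subst hn
  rcases subsingleton_or_nontrivial V with hV | hV
  · exact ⟨0, zero_mem _, fun g => by
      rw [Subsingleton.elim (A ∘ₗ ρ g) 0, map_zero, Pi.zero_apply]⟩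
  have hA' : ∀ g v, A (ρ g v) = ρ g (A v) := fun g v => LinearMap.congr_fun (hA g) v
  by_cases hU : ∃ U : Submodule ℂ V, (∀ g, ∀ v ∈ U, ρ g v ∈ U) ∧ (∀ v ∈ U, A v ∈ U) ∧
    U ≠ ⊥ ∧ U ≠ ⊤
  · obtain ⟨U, hUρ, hUA, hbot, htop⟩ := hU
    let ρ₁ : Representation ℂ G U :=
      { toFun := fun g => (ρ g).restrict (hUρ g)
        map_one' := by ext; simp
        map_mul' := fun a b => by ext; simp }
    let ρ₂ : Representation ℂ G (V ⧸ U) :=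
      { toFun := fun g => U.mapQ U (ρ g) (hUρ g)
        map_one' := by ext; simp
        map_mul' := fun a b => by ext; simp }
    have h₁ : ρ₁.ContinuousCoeff := fun v φ => by
      obtain ⟨ψ, hψ⟩ := LinearMap.exists_extend φ
      have := hρ v ψ
      convert this using 2 with g
      rw [← hψ]; rfl
    have h₂ : ρ₂.ContinuousCoeff := fun v φ => by
      obtain ⟨v, rfl⟩ := U.mkQ_surjective v
      exact hρ v (φ ∘ₗ U.mkQ)
    obtain ⟨k₁, hk₁, hk₁'⟩ := ih _ (Submodule.finrank_lt htop) h₁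
      (A := A.restrict hUA) (fun g => by ext v; exact hA' g v) rfl
    have hlt : Module.finrank ℂ (V ⧸ U) < Module.finrank ℂ V := by
      have := U.finrank_quotient_add_finrank
      have := Submodule.one_le_finrank_iff.2 hbot
      omega
    obtain ⟨k₂, hk₂, hk₂'⟩ := ih _ hlt h₂
      (A := U.mapQ U A hUA) (fun g => by ext v; exact congrArg U.mkQ (hA' g v)) rfl
    refine ⟨k₁ + k₂, add_mem hk₁ hk₂, fun g => ?_⟩
    rw [Pi.add_apply, hk₁', hk₂', LinearMap.trace_eq_trace_restrict_add_trace_mapQ (A ∘ₗ ρ g) U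
      (fun v hv => hUA _ (hUρ g v hv))]
    congr 2
    ext v; rfl
  · push Not at hU
    obtain ⟨c, hc⟩ := Module.End.exists_eigenvalue A
    have hE := hU (Module.End.eigenspace A c)
      (fun g v hv => by
        rw [Module.End.mem_eigenspace_iff] at hv ⊢
        rw [hA', hv, map_smul])
      (fun v hv => by
        rw [Module.End.mem_eigenspace_iff] at hv ⊢
        rw [hv, map_smul, hv]) hc
    have hAc : A = c • LinearMap.id := by
      ext v
      exact Module.End.mem_eigenspace_iff.1 (hE ▸ Submodule.mem_top)
    have hirr : ρ.IsIrreducible := by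
      refine isIrreducible_iff_forall_submodule.2 ⟨hV, fun U hUρ => ?_⟩
      refine or_iff_not_imp_left.2 (hU U hUρ fun v hv => ?_)
      rw [hAc]
      exact U.smul_mem c hv
    obtain ⟨χ, hχ, hχ'⟩ := exists_isIrreducibleCharacter hρ hirr
    refine ⟨c • χ, Submodule.smul_mem _ _ (Submodule.subset_span hχ), fun g => ?_⟩
    rw [Pi.smul_apply, hχ', hAc, LinearMap.smul_comp, map_smul, LinearMap.id_comp]
    rfl

end Representation

/-! ### Weak integrals of operators -/

theorem Continuous.integrable_of_compactSpace {G : Type*} [TopologicalSpace G] [CompactSpace G]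
    [MeasurableSpace G] [BorelSpace G] (μ : Measure G) [IsFiniteMeasure μ] {f : G → ℂ}
    (hf : Continuous f) : Integrable f μ :=
  Integrable.of_bound hf.measurable.aestronglyMeasurable ‖(⟨f, hf⟩ : C(G, ℂ))‖
    (Eventually.of_forall fun x => (⟨f, hf⟩ : C(G, ℂ)).norm_coe_le_norm x)

section WeakIntegral

variable {G V : Type*} [TopologicalSpace G] [CompactSpace G] [MeasurableSpace G] [BorelSpace G]
  [AddCommGroup V] [Module ℂ V] [Module.Finite ℂ V]

/-- The weak integral of a family of endomorphisms with continuous matrix coefficients. -/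
theorem LinearMap.exists_weak_integral (μ : Measure G) [IsFiniteMeasure μ] {F : G → V →ₗ[ℂ] V}
    (hF : ∀ (v : V) (φ : V →ₗ[ℂ] ℂ), Continuous fun g => φ (F g v)) :
    ∃ T : V →ₗ[ℂ] V, ∀ (v : V) (φ : V →ₗ[ℂ] ℂ), φ (T v) = ∫ g, φ (F g v) ∂μ := by
  let b := Module.finBasis ℂ V
  have hi : ∀ (v : V) (φ : V →ₗ[ℂ] ℂ), Integrable (fun g => φ (F g v)) μ := fun v φ =>
    (hF v φ).integrable_of_compactSpace μ
  refine ⟨{ toFun := fun v => ∑ i, (∫ g, b.coord i (F g v) ∂μ) • b i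
            map_add' := fun v w => ?_
            map_smul' := fun c v => ?_ }, fun v φ => ?_⟩
  · simp only [map_add]
    rw [← Finset.sum_add_distrib]
    refine Finset.sum_congr rfl fun i _ => ?_
    rw [integral_add (hi _ _) (hi _ _), add_smul]
  · simp only [map_smul, smul_eq_mul, integral_const_mul, mul_smul, Finset.smul_sum,
      RingHom.id_apply]
  · have h : ∀ g, φ (F g v) = ∑ i, b.coord i (F g v) * φ (b i) := fun g => by
      conv_lhs => rw [← b.sum_repr (F g v), map_sum]
      simp
    simp only [h]
    rw [integral_finsetSum _ fun i _ => (hi v (b.coord i)).mul_const _]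
    simp [integral_mul_const]

theorem LinearMap.trace_comp_weak_integral {μ : Measure G} [IsFiniteMeasure μ]
    {F : G → V →ₗ[ℂ] V}
    (hF : ∀ (v : V) (φ : V →ₗ[ℂ] ℂ), Continuous fun g => φ (F g v)) {T : V →ₗ[ℂ] V}
    (hT : ∀ (v : V) (φ : V →ₗ[ℂ] ℂ), φ (T v) = ∫ g, φ (F g v) ∂μ) (C : V →ₗ[ℂ] V) :
    LinearMap.trace ℂ V (C ∘ₗ T) = ∫ g, LinearMap.trace ℂ V (C ∘ₗ F g) ∂μ := by
  let b := Module.finBasis ℂ V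
  simp only [b.trace_eq_sum_coord]
  refine Eq.trans ?_ (integral_finsetSum _ fun i _ =>
    (hF (b i) (b.coord i ∘ₗ C)).integrable_of_compactSpace μ).symm
  exact Finset.sum_congr rfl fun i _ => hT (b i) (b.coord i ∘ₗ C)

theorem LinearMap.eq_of_forall_dual_eq {v w : V} (h : ∀ φ : V →ₗ[ℂ] ℂ, φ v = φ w) : v = w :=
  (Module.finBasis ℂ V).ext_elem fun i => h ((Module.finBasis ℂ V).coord i)

end WeakIntegral

/-! ### Averaging over the group -/

namespace Representation

variable {G V : Type*} [Group G] [TopologicalSpace G] [IsTopologicalGroup G] [CompactSpace G]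
  [MeasurableSpace G] [BorelSpace G] (μ : Measure G) [IsFiniteMeasure μ] [μ.IsMulLeftInvariant]
  [AddCommGroup V] [Module ℂ V] [Module.Finite ℂ V]

/-- The average of `ρ` has image in the fixed vectors. If it is nonzero, a fixed vector spans `V` by
irreducibility, so `ρ` is trivial of dimension one. -/
theorem integral_character_eq_zero {ρ : Representation ℂ G V} (hρ : ρ.ContinuousCoeff)
    (hirr : ρ.IsIrreducible) (h : ρ.character ≠ 1) : ∫ g, ρ.character g ∂μ = 0 := by
  obtain ⟨T, hT⟩ := LinearMap.exists_weak_integral μ (F := fun g => ρ g) hρ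
  have htr : LinearMap.trace ℂ V T = ∫ g, ρ.character g ∂μ :=
    LinearMap.trace_comp_weak_integral hρ hT LinearMap.id
  have hinv : ∀ g v, ρ g (T v) = T v := fun g v =>
    LinearMap.eq_of_forall_dual_eq fun φ => by
      have h1 := hT v (φ ∘ₗ ρ g)
      rw [LinearMap.comp_apply] at h1
      rw [h1, hT, ← integral_mul_left_eq_self (fun x => φ (ρ x v)) g]
      simp [map_mul]
  suffices hT0 : T = 0 by rw [← htr, hT0, map_zero]
  by_contra hT0
  obtain ⟨v, hv⟩ : ∃ v, T v ≠ 0 := by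
    by_contra! h0
    exact hT0 (LinearMap.ext h0)
  have hspan : Submodule.span ℂ {T v} = ⊤ := by
    refine ((isIrreducible_iff_forall_submodule.1 hirr).2 _ fun g w hw => ?_).resolve_left
      (by rwa [Submodule.span_singleton_eq_bot])
    obtain ⟨c, rfl⟩ := Submodule.mem_span_singleton.1 hw
    rw [map_smul, hinv]
    exact hw
  refine h (funext fun g => ?_)
  have hid : ρ g = LinearMap.id := by
    ext w
    obtain ⟨c, rfl⟩ := Submodule.mem_span_singleton.1 (hspan ▸ Submodule.mem_top : w ∈ _)
    rw [map_smul, hinv, LinearMap.id_apply]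
  have hone : Module.finrank ℂ V = 1 := by
    rw [← finrank_top ℂ V, ← hspan, finrank_span_singleton hv]
  rw [Representation.character, hid, LinearMap.trace_id, hone]
  simp

/-- The conjugation average of a matrix coefficient is a combination of irreducible characters. -/
theorem exists_mem_characterSpan_integral_coeff {ρ : Representation ℂ G V}
    (hρ : ρ.ContinuousCoeff) (v : V) (φ : V →ₗ[ℂ] ℂ) :
    ∃ k ∈ characterSpan G, ∀ x,
      k (ConjClasses.mk x) = ∫ g, φ (ρ (g⁻¹ * x * g) v) ∂μ := by
  -- The conjugate by `ρ g` of the rank-one map `w ↦ φ w • v`. Its average commutes with `ρ`, and `ρ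
  -- x ∘ F g` has trace `φ (ρ (g⁻¹ * x * g) v)`.
  let F : G → V →ₗ[ℂ] V := fun g => (φ ∘ₗ ρ g⁻¹).smulRight (ρ g v)
  have hF : ∀ (w : V) (ψ : V →ₗ[ℂ] ℂ), Continuous fun g => ψ (F g w) := fun w ψ => by
    simp only [F, LinearMap.smulRight_apply, map_smul, smul_eq_mul, LinearMap.comp_apply]
    exact ((hρ w φ).comp continuous_inv).mul (hρ v ψ)
  obtain ⟨T, hT⟩ := LinearMap.exists_weak_integral μ hF
  have hcomm : ∀ x, T ∘ₗ ρ x = ρ x ∘ₗ T := fun x => by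
    ext w
    refine LinearMap.eq_of_forall_dual_eq fun ψ => ?_
    have h1 := hT w (ψ ∘ₗ ρ x)
    rw [LinearMap.comp_apply] at h1
    rw [LinearMap.comp_apply, LinearMap.comp_apply, h1, hT,
      ← integral_mul_left_eq_self (fun g => (ψ ∘ₗ ρ x) (F g w)) x⁻¹]
    simp [F, map_mul]
  obtain ⟨k, hk, hk'⟩ := exists_mem_characterSpan_trace_comp hρ hcomm
  refine ⟨k, hk, fun x => ?_⟩
  rw [hk', hcomm, LinearMap.trace_comp_weak_integral hF hT]
  refine integral_congr_ae (Eventually.of_forall fun g => ?_)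
  have : ρ x ∘ₗ F g = (φ ∘ₗ ρ g⁻¹).smulRight (ρ x (ρ g v)) := by
    ext w; simp [F]
  simp only [this, LinearMap.trace_smulRight, LinearMap.comp_apply, map_mul, Module.End.mul_apply]

end Representation

/-! ### Left-invariant spaces of functions -/

section LeftInvariant

variable {G : Type*} [Group G] [TopologicalSpace G] [IsTopologicalGroup G]

theorem ContinuousMap.continuous_comp_mulLeft_inv (h : C(G, ℂ)) :
    Continuous fun g : G => h.comp (ContinuousMap.mulLeft g⁻¹) :=
  (ContinuousMap.curry ⟨fun p : G × G => h (p.1⁻¹ * p.2), by fun_prop⟩).continuous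

/-- The integrand is a coefficient of left translation on `W`, paired with evaluation at `1`; since
translation by `g` precomposes with `g⁻¹`, the argument `x` appears inverted. -/
theorem exists_mem_characterSpan_integral_conj [CompactSpace G] [MeasurableSpace G] [BorelSpace G] (μ : Measure G)
    [IsFiniteMeasure μ] [μ.IsMulLeftInvariant] {W : Submodule ℂ C(G, ℂ)} [FiniteDimensional ℂ W]
    (hW : ∀ (g : G), ∀ h ∈ W, h.comp (ContinuousMap.mulLeft g⁻¹) ∈ W) {h : C(G, ℂ)} (hh : h ∈ W) :
    ∃ k ∈ Representation.characterSpan G, ∀ x,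
      k (ConjClasses.mk x) = ∫ g, h (g⁻¹ * x⁻¹ * g) ∂μ := by
  let ρ : Representation ℂ G W :=
    { toFun := fun g =>
        { toFun := fun w => ⟨w.1.comp (ContinuousMap.mulLeft g⁻¹), hW g w w.2⟩
          map_add' := fun a b => rfl
          map_smul' := fun a b => rfl }
      map_one' := by ext; simp
      map_mul' := fun a b => by ext; simp [mul_assoc] }
  have hρ : ρ.ContinuousCoeff := fun w φ =>
    (LinearMap.continuous_of_finiteDimensional φ).comp
      (Continuous.subtype_mk (ContinuousMap.continuous_comp_mulLeft_inv w.1) _)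
  let φ : W →ₗ[ℂ] ℂ :=
    { toFun := fun w => w.1 1
      map_add' := fun a b => rfl
      map_smul' := fun a b => rfl }
  obtain ⟨k, hk, hk'⟩ := Representation.exists_mem_characterSpan_integral_coeff μ hρ ⟨h, hh⟩ φ
  refine ⟨k, hk, fun x => (hk' x).trans (integral_congr_ae (Eventually.of_forall fun g => ?_))⟩
  simp [φ, ρ, mul_assoc]

end LeftInvariant

/-! ### Compactness of kernel operators -/

section KernelOperator

variable {X H : Type*} [TopologicalSpace X] [CompactSpace X] [NormedAddCommGroup H]
  [InnerProductSpace ℂ H]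

/-- The operator `f ↦ (x ↦ ⟪Φ x, f⟫)` from a Hilbert space to continuous functions. -/
noncomputable def innerOperator (Φ : C(X, H)) : H →L[ℂ] C(X, ℂ) :=
  LinearMap.mkContinuous
    { toFun := fun f => ⟨fun x => inner ℂ (Φ x) f, by fun_prop⟩
      map_add' := fun f g => by ext; simp
      map_smul' := fun c f => by ext; simp }
    ‖Φ‖
    (fun f => (ContinuousMap.norm_le _ (by positivity)).2 fun x =>
      (norm_inner_le_norm _ _).trans
        (mul_le_mul_of_nonneg_right (Φ.norm_coe_le_norm x) (norm_nonneg f)))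

@[simp]
theorem innerOperator_apply (Φ : C(X, H)) (f : H) (x : X) :
    innerOperator Φ f x = inner ℂ (Φ x) f := rfl

/-- Arzelà–Ascoli: by Cauchy–Schwarz, continuity of `Φ` makes the image of the unit ball
equicontinuous. -/
theorem isCompactOperator_innerOperator (Φ : C(X, H)) : IsCompactOperator (innerOperator Φ) := by
  let L := ContinuousMap.linearIsometryBoundedOfCompact X ℂ ℂ
  let A : Set (BoundedContinuousFunction X ℂ) :=
    (fun f => L (innerOperator Φ f)) '' Metric.ball 0 1
  have hA : IsCompact (closure A) := by
    refine BoundedContinuousFunction.arzela_ascoli (Metric.closedBall 0 ‖Φ‖)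
      (isCompact_closedBall _ _) A ?_ ?_
    · rintro _ x ⟨f, hf, rfl⟩
      rw [mem_ball_zero_iff] at hf
      rw [mem_closedBall_zero_iff]
      refine (norm_inner_le_norm (Φ x) f).trans ?_
      exact (mul_le_of_le_one_right (norm_nonneg _) hf.le).trans (Φ.norm_coe_le_norm x)
    · intro x₀
      rw [Metric.equicontinuousAt_iff_right]
      intro ε hε
      filter_upwards [Metric.continuousAt_iff'.1 Φ.continuous.continuousAt ε hε] with x hx
      rintro ⟨_, f, hf, rfl⟩
      rw [mem_ball_zero_iff] at hf
      rw [dist_comm, dist_eq_norm] at hx ⊢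
      rw [← norm_neg, neg_sub]
      change ‖inner ℂ (Φ x₀) f - inner ℂ (Φ x) f‖ < ε
      rw [← inner_sub_left]
      refine (norm_inner_le_norm _ f).trans_lt ?_
      exact (mul_le_of_le_one_right (norm_nonneg _) hf.le).trans_lt hx
  have hL : IsCompactOperator (fun f => L (innerOperator Φ f)) :=
    (isCompactOperator_iff_isCompact_closure_image_ball
      (L.toLinearEquiv.toLinearMap ∘ₗ (innerOperator Φ).toLinearMap) one_pos).2 hA
  have h : (innerOperator Φ : H → C(X, ℂ)) = L.symm ∘ fun f => L (innerOperator Φ f) :=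
    funext fun f => (L.symm_apply_apply _).symm
  rw [h]
  exact hL.continuous_comp L.symm.continuous

end KernelOperator

/-! ### Spectral theory through a factorization -/

section CompactSymmetric

variable {E H : Type*} [NormedAddCommGroup E] [NormedSpace ℂ E] [NormedAddCommGroup H]
  [InnerProductSpace ℂ H] [CompleteSpace H] {j : E →L[ℂ] H} {S : H →L[ℂ] E}

/-- `j` embeds the eigenspace into that of the compact operator `j ∘L S`. Using `S ∘L j` keeps
eigenvectors in `E`, later the continuous functions. -/
theorem finiteDimensional_eigenspace_comp (hj : Function.Injective j) (hS : IsCompactOperator S)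
    {c : ℂ} (hc : c ≠ 0) :
    FiniteDimensional ℂ (Module.End.eigenspace (S ∘L j).toLinearMap c) := by
  have hT : IsCompactOperator (j ∘L S) := hS.clm_comp j
  have := ContinuousLinearMap.finite_dimensional_eigenspace hT c hc
  let e : Module.End.eigenspace (S ∘L j).toLinearMap c →ₗ[ℂ]
      Module.End.eigenspace (j ∘L S).toLinearMap c :=
    j.toLinearMap.restrict fun h hh => by
      rw [Module.End.mem_eigenspace_iff] at hh ⊢
      change S (j h) = c • h at hh
      change j (S (j h)) = c • j h
      rw [hh, map_smul]
  refine FiniteDimensional.of_injective e fun a b hab => Subtype.ext (hj ?_)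
  exact congrArg Subtype.val hab

/-- The range of `S` is approximated by sums of eigenvectors of `S ∘ j`. -/
theorem mem_topologicalClosure_iSup_eigenspace (hj : Function.Injective j)
    (hS : IsCompactOperator S) (hsymm : (j ∘L S).toLinearMap.IsSymmetric) (f : H) :
    S f ∈ (⨆ (c : ℂ) (_ : c ≠ 0),
      Module.End.eigenspace (S ∘L j).toLinearMap c).topologicalClosure := by
  have hT : IsCompactOperator (j ∘L S) := hS.clm_comp j
  have htop := Submodule.topologicalClosure_eq_top_iff.2
    (ContinuousLinearMap.orthogonalComplement_iSup_eigenspaces_eq_bot hT hsymm)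
  have hf : f ∈ closure ((⨆ c, Module.End.eigenspace (j ∘L S).toLinearMap c : Submodule ℂ H) :
      Set H) := by
    rw [← Submodule.topologicalClosure_coe, htop]
    trivial
  refine map_mem_closure S.continuous hf fun v hv => ?_
  suffices h : (⨆ c, Module.End.eigenspace (j ∘L S).toLinearMap c).map S.toLinearMap ≤
      ⨆ (c : ℂ) (_ : c ≠ 0), Module.End.eigenspace (S ∘L j).toLinearMap c from
    h (Submodule.mem_map_of_mem hv)
  rw [Submodule.map_iSup]
  refine iSup_le fun c => ?_
  rintro _ ⟨v, hv, rfl⟩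
  have hv' : j (S v) = c • v := Module.End.mem_eigenspace_iff.1 hv
  by_cases hc : c = 0
  · have : S v = 0 := hj (by rw [hv', hc, zero_smul, map_zero])
    change S v ∈ _
    rw [this]
    exact zero_mem _
  · refine Submodule.mem_iSup_of_mem c (Submodule.mem_iSup_of_mem hc ?_)
    rw [Module.End.mem_eigenspace_iff]
    change S (j (S v)) = c • S v
    rw [hv', map_smul]

end CompactSymmetric

/-! ### Continuous functions inside `L²` -/

section ContinuousL2

variable {X : Type*} [TopologicalSpace X] [CompactSpace X] [MeasurableSpace X] [BorelSpace X]
  (μ : Measure X) [IsFiniteMeasure μ]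

/-- The closure of the space of continuous functions in `L²`. -/
abbrev ContinuousL2 : Type _ :=
  (ContinuousMap.toLp (E := ℂ) 2 μ ℂ).range.topologicalClosure

/-- The inclusion of continuous functions into their `L²`-closure. -/
noncomputable def toContinuousL2 : C(X, ℂ) →L[ℂ] ContinuousL2 μ :=
  (ContinuousMap.toLp (E := ℂ) 2 μ ℂ).codRestrict _ fun f =>
    Submodule.le_topologicalClosure _ (LinearMap.mem_range_self _ f)

theorem inner_toContinuousL2 (f h : C(X, ℂ)) :
    inner ℂ (toContinuousL2 μ f) (toContinuousL2 μ h) = ∫ x, h x * (starRingEnd ℂ) (f x) ∂μ :=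
  ContinuousMap.inner_toLp μ f h

theorem toContinuousL2_injective [μ.IsOpenPosMeasure] :
    Function.Injective (toContinuousL2 μ) := fun _ _ h =>
  ContinuousMap.toLp_injective μ (congrArg Subtype.val h)

theorem denseRange_toContinuousL2 : DenseRange (toContinuousL2 μ) := by
  rintro ⟨f, hf⟩
  rw [closure_subtype]
  have h : Subtype.val '' Set.range (toContinuousL2 μ) =
      ((ContinuousMap.toLp (E := ℂ) 2 μ ℂ).range : Set (Lp ℂ 2 μ)) := by
    rw [← Set.range_comp]
    rfl
  rw [h]
  exact hf

end ContinuousL2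

/-! ### Peter–Weyl density -/

section PeterWeyl

variable {G : Type*} [Group G] [TopologicalSpace G] [IsTopologicalGroup G]

/-- The span of the finite-dimensional left-invariant spaces of continuous functions. -/
noncomputable def representativeFunctions (G : Type*) [Group G] [TopologicalSpace G] [IsTopologicalGroup G] :
    Submodule ℂ C(G, ℂ) :=
  sSup {W | FiniteDimensional ℂ W ∧
    ∀ (g : G), ∀ h ∈ W, h.comp (ContinuousMap.mulLeft g⁻¹) ∈ W}

variable [CompactSpace G]

/-- A nonnegative symmetric bump function, supported where right translation moves `F` by at most
`ε`. -/
theorem exists_bump_of_continuousMap (F : C(G, ℂ)) {ε : ℝ} (hε : 0 < ε) :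
    ∃ k : C(G, ℝ), (∀ u, 0 ≤ k u) ∧ (∀ u, k u⁻¹ = k u) ∧ k 1 ≠ 0 ∧
      ∀ u x, k u ≠ 0 → ‖F (x * u) - F x‖ ≤ ε := by
  let R : C(G, C(G, ℂ)) := ContinuousMap.curry ⟨fun p : G × G => F (p.2 * p.1), by fun_prop⟩
  have hR : ∀ u x, R u x = F (x * u) := fun u x => rfl
  have hle : ∀ u, ‖R u⁻¹ - F‖ ≤ ‖R u - F‖ := fun u => by
    refine (ContinuousMap.norm_le _ (norm_nonneg _)).2 fun x => ?_
    have := (R u - F).norm_coe_le_norm (x * u⁻¹)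
    rw [ContinuousMap.sub_apply, hR, inv_mul_cancel_right, norm_sub_rev] at this
    exact this
  -- Nonzero exactly where right translation by `u` moves `F` by less than `ε` in sup norm.
  refine ⟨⟨fun u => max 0 (ε - ‖R u - F‖), by fun_prop⟩, fun u => le_max_left _ _, fun u => ?_,
    ?_, fun u x hu => ?_⟩
  · have : ‖R u⁻¹ - F‖ = ‖R u - F‖ :=
      le_antisymm (hle u) (by simpa using hle u⁻¹)
    simp only [ContinuousMap.coe_mk, this]
  · have : R 1 = F := by ext x; rw [hR, mul_one]
    simp [this, hε.le, hε.ne']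
  · have h0 : 0 < ε - ‖R u - F‖ := by
      by_contra! h
      exact hu (max_eq_left h)
    have := (R u - F).norm_coe_le_norm x
    rw [ContinuousMap.sub_apply, hR] at this
    linarith

variable [MeasurableSpace G] [BorelSpace G] (μ : Measure G) [IsFiniteMeasure μ]

/-- Convolution with the kernel `k (x⁻¹ * y)`, from `L²` to continuous functions. -/
noncomputable def convolutionOperator (k : C(G, ℝ)) : ContinuousL2 μ →L[ℂ] C(G, ℂ) :=
  innerOperator ⟨fun x => toContinuousL2 μ
    (ContinuousMap.curry ⟨fun p : G × G => (k (p.1⁻¹ * p.2) : ℂ), by fun_prop⟩ x), by fun_prop⟩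

theorem convolutionOperator_apply (k : C(G, ℝ)) (h : C(G, ℂ)) (x : G) :
    convolutionOperator μ k (toContinuousL2 μ h) x = ∫ y, h y * (k (x⁻¹ * y) : ℂ) ∂μ := by
  rw [convolutionOperator, innerOperator_apply, ContinuousMap.coe_mk, inner_toContinuousL2]
  simp

theorem isSymmetric_convolutionOperator {k : C(G, ℝ)} (hk : ∀ u, k u⁻¹ = k u) :
    (toContinuousL2 μ ∘L convolutionOperator μ k).toLinearMap.IsSymmetric := by
  intro f g
  let T := toContinuousL2 μ ∘L convolutionOperator μ k
  change inner ℂ (T f) g = inner ℂ f (T g)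
  refine (denseRange_toContinuousL2 μ).induction_on₂
    (p := fun f g => inner ℂ (T f) g = inner ℂ f (T g))
    (isClosed_eq ((T.continuous.comp continuous_fst).inner continuous_snd)
      (continuous_fst.inner (T.continuous.comp continuous_snd))) (fun a b => ?_) f g
  change inner ℂ (toContinuousL2 μ (convolutionOperator μ k (toContinuousL2 μ a))) _ =
    inner ℂ _ (toContinuousL2 μ (convolutionOperator μ k (toContinuousL2 μ b)))
  rw [inner_toContinuousL2, inner_toContinuousL2]
  simp only [convolutionOperator_apply, ← integral_conj, ← integral_const_mul,
    ← integral_mul_const, map_mul, Complex.conj_ofReal]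
  -- This form of Fubini, for continuous integrands, requires no σ-finiteness or countability of the
  -- topology.
  rw [integral_integral_swap_of_hasCompactSupport (by fun_prop)
    (HasCompactSupport.of_compactSpace _)]
  refine integral_congr_ae (Eventually.of_forall fun x => integral_congr_ae
    (Eventually.of_forall fun y => ?_))
  have : k (y⁻¹ * x) = k (x⁻¹ * y) := by rw [← hk]; simp
  simp only [this]
  ring

variable [μ.IsMulLeftInvariant]

/-- The kernel `k (x⁻¹ * y)` and `μ` are both left-invariant, so convolution commutes with left
translation. -/
theorem comp_mulLeft_mem_eigenspace {k : C(G, ℝ)} {c : ℂ} (g : G) {h : C(G, ℂ)}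
    (hh : h ∈ Module.End.eigenspace (convolutionOperator μ k ∘L toContinuousL2 μ).toLinearMap c) :
    h.comp (ContinuousMap.mulLeft g⁻¹) ∈
      Module.End.eigenspace (convolutionOperator μ k ∘L toContinuousL2 μ).toLinearMap c := by
  rw [Module.End.mem_eigenspace_iff] at hh ⊢
  change convolutionOperator μ k (toContinuousL2 μ _) = _ at hh ⊢
  ext x
  have := congrArg (fun f : C(G, ℂ) => f (g⁻¹ * x)) hh
  simp only [convolutionOperator_apply, ContinuousMap.smul_apply] at this
  rw [convolutionOperator_apply, ContinuousMap.smul_apply, ContinuousMap.comp_apply,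
    ContinuousMap.coe_mulLeft, ← this, ← integral_mul_left_eq_self _ g]
  simp [mul_assoc]

/-- The density part of the Peter-Weyl theorem. -/
theorem exists_mem_representativeFunctions_norm_sub_lt [μ.IsOpenPosMeasure] (F : C(G, ℂ)) {ε : ℝ}
    (hε : 0 < ε) : ∃ h ∈ representativeFunctions G, ‖F - h‖ < ε := by
  obtain ⟨k, hk0, hksymm, hk1, hkF⟩ := exists_bump_of_continuousMap F (half_pos hε)
  set S := convolutionOperator μ k with hS
  set j := toContinuousL2 μ with hj
  have hint : ∀ f : C(G, ℂ), Integrable f μ := fun f => f.continuous.integrable_of_compactSpace μ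
  have hkint : Integrable k μ := by
    have := (hint ⟨fun x => (k x : ℂ), by fun_prop⟩).re
    simpa using this
  have hc : 0 < ∫ u, k u ∂μ :=
    k.continuous.integral_pos_of_hasCompactSupport_nonneg_nonzero
      (HasCompactSupport.of_compactSpace _) hk0 hk1
  set c := ∫ u, k u ∂μ with hcdef
  -- `S (j F) x` integrates `F (x * u)` with weight `k u`, which vanishes unless `F (x * u)` is
  -- within `ε / 2` of `F x`.
  have happrox : ‖S (j F) - (c : ℂ) • F‖ ≤ ε / 2 * c := by
    refine (ContinuousMap.norm_le _ (by positivity)).2 fun x => ?_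
    have h1 : S (j F) x = ∫ u, F (x * u) * (k u : ℂ) ∂μ := by
      rw [hS, hj, convolutionOperator_apply, ← integral_mul_left_eq_self _ x]
      simp
    have h2 : ((c : ℂ) • F) x = ∫ u, F x * (k u : ℂ) ∂μ := by
      rw [integral_const_mul, integral_complex_ofReal, ContinuousMap.smul_apply, smul_eq_mul,
        mul_comm]
    rw [ContinuousMap.sub_apply, h1, h2, ← integral_sub
      (Continuous.integrable_of_compactSpace μ (by fun_prop))
      (Continuous.integrable_of_compactSpace μ (by fun_prop)), hcdef, ← integral_const_mul]
    refine norm_integral_le_of_norm_le (hkint.const_mul _) (Eventually.of_forall fun u => ?_)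
    rw [← sub_mul, norm_mul, Complex.norm_real, Real.norm_of_nonneg (hk0 u)]
    by_cases hu : k u = 0
    · simp [hu]
    · exact mul_le_mul_of_nonneg_right (hkF u x hu) (hk0 u)
  have hSc : IsCompactOperator S := isCompactOperator_innerOperator _
  have hjinj : Function.Injective j := toContinuousL2_injective μ
  have hmem := mem_topologicalClosure_iSup_eigenspace hjinj hSc
    (isSymmetric_convolutionOperator μ hksymm) (j F)
  have hle : (⨆ (c : ℂ) (_ : c ≠ 0), Module.End.eigenspace (S ∘L j).toLinearMap c) ≤
      representativeFunctions G :=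
    iSup₂_le fun a ha => le_sSup ⟨finiteDimensional_eigenspace_comp hjinj hSc ha,
      fun g h hh => comp_mulLeft_mem_eigenspace μ g hh⟩
  obtain ⟨h, hh, hd⟩ := Metric.mem_closure_iff.1 hmem (ε / 2 * c) (by positivity)
  refine ⟨(c : ℂ)⁻¹ • h, Submodule.smul_mem _ _ (hle hh), ?_⟩
  have hc' : (c : ℂ) ≠ 0 := by exact_mod_cast hc.ne'
  have heq : F - (c : ℂ)⁻¹ • h = (c : ℂ)⁻¹ • ((S (j F) - h) - (S (j F) - (c : ℂ) • F)) := by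
    rw [sub_sub_sub_cancel_left, smul_sub, smul_smul, inv_mul_cancel₀ hc', one_smul]
  rw [dist_eq_norm] at hd
  rw [heq, norm_smul, norm_inv, Complex.norm_real, Real.norm_of_nonneg hc.le,
    inv_mul_lt_iff₀ hc]
  calc _ ≤ ‖S (j F) - h‖ + ‖S (j F) - (c : ℂ) • F‖ := norm_sub_le _ _
    _ < ε / 2 * c + ε / 2 * c := add_lt_add_of_lt_of_le hd happrox
    _ = c * ε := by ring

theorem exists_mem_characterSpan_of_mem_representativeFunctions {h : C(G, ℂ)}
    (hh : h ∈ representativeFunctions G) :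
    ∃ k ∈ Representation.characterSpan G, ∀ x,
      k (ConjClasses.mk x) = ∫ g, h (g⁻¹ * x⁻¹ * g) ∂μ := by
  rw [representativeFunctions, sSup_eq_iSup'] at hh
  refine Submodule.iSup_induction _ (motive := fun h : C(G, ℂ) =>
    ∃ k ∈ Representation.characterSpan G, ∀ x,
      k (ConjClasses.mk x) = ∫ g, h (g⁻¹ * x⁻¹ * g) ∂μ) hh ?_ ?_ ?_
  · rintro ⟨W, _, hW⟩ h hh
    exact exists_mem_characterSpan_integral_conj μ hW hh
  · exact ⟨0, zero_mem _, by simp⟩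
  · rintro a b ⟨k, hk, hk'⟩ ⟨l, hl, hl'⟩
    refine ⟨k + l, add_mem hk hl, fun x => ?_⟩
    rw [Pi.add_apply, hk', hl', ← integral_add]
    · rfl
    · exact Continuous.integrable_of_compactSpace μ (by fun_prop)
    · exact Continuous.integrable_of_compactSpace μ (by fun_prop)

/-- Averaging over conjugates against a probability measure fixes class functions and does not
increase sup norms, so it preserves the approximation. -/
theorem exists_mem_characterSpan_norm_sub_le [μ.IsOpenPosMeasure] [IsProbabilityMeasure μ]
    (f : C(ConjClasses G, ℂ)) {ε : ℝ} (hε : 0 < ε) :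
    ∃ k ∈ Representation.characterSpan G, ∀ x, ‖f x - k x‖ ≤ ε := by
  have hf := f.continuous.comp (ConjClasses.continuous_mk_quotient (G := G))
  -- The inverse cancels the one in the conjugation average.
  obtain ⟨h, hh, hd⟩ := exists_mem_representativeFunctions_norm_sub_lt μ
    (⟨fun x => f (ConjClasses.mk x⁻¹), hf.comp continuous_inv⟩ : C(G, ℂ)) hε
  obtain ⟨k, hk, hk'⟩ := exists_mem_characterSpan_of_mem_representativeFunctions μ hh
  refine ⟨k, hk, fun x => ?_⟩
  obtain ⟨x, rfl⟩ := ConjClasses.mk_surjective x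
  have hfx : f (ConjClasses.mk x) = ∫ _ : G, f (ConjClasses.mk x) ∂μ := by simp
  rw [hk', hfx, ← integral_sub (integrable_const _)
    (Continuous.integrable_of_compactSpace μ (by fun_prop))]
  refine (norm_integral_le_of_norm_le_const (C := ε) (Eventually.of_forall fun g => ?_)).trans
    (by simp)
  refine le_trans (le_of_eq ?_) ((ContinuousMap.norm_coe_le_norm _ (g⁻¹ * x⁻¹ * g)).trans hd.le)
  have : ConjClasses.mk x = ConjClasses.mk (g⁻¹ * x⁻¹ * g)⁻¹ :=
    ConjClasses.mk_eq_mk_iff_isConj.2 (isConj_iff.2 ⟨g⁻¹, by group⟩)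
  rw [this]
  rfl

end PeterWeyl

/-! ### Weyl's criterion -/

theorem IsIrreducibleCharacter.continuous {G : Type*} [Group G] [TopologicalSpace G]
    {χ : ConjClasses G → ℂ} (h : IsIrreducibleCharacter χ) : Continuous χ := by
  obtain ⟨n, ρ, hc, -, rfl⟩ := h
  exact (isQuotientMap_quotient_mk' (s := IsConj.setoid G)).continuous_iff.2
    (Representation.continuousCoeff_of_continuous hc).continuous_character

section Equidistribution

variable {G : Type*} [Group G] [TopologicalSpace G] [IsTopologicalGroup G] [CompactSpace G]
  [MeasurableSpace G] [BorelSpace G] (μ : Measure G)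

theorem IsIrreducibleCharacter.integral_eq_zero [IsFiniteMeasure μ] [μ.IsMulLeftInvariant]
    {χ : ConjClasses G → ℂ} (h : IsIrreducibleCharacter χ) (h1 : χ ≠ 1) :
    ∫ g, χ (ConjClasses.mk g) ∂μ = 0 := by
  obtain ⟨n, ρ, hc, hirr, rfl⟩ := h
  refine Representation.integral_character_eq_zero μ
    (Representation.continuousCoeff_of_continuous hc) hirr fun h => h1 (funext fun x => ?_)
  obtain ⟨g, rfl⟩ := ConjClasses.mk_surjective x
  exact congrFun h g

theorem tendsto_average_of_mem_characterSpan [μ.IsMulLeftInvariant] [IsProbabilityMeasure μ]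
    {x : ℕ → ConjClasses G}
    (hx : ∀ χ : ConjClasses G → ℂ, IsIrreducibleCharacter χ → χ ≠ 1 →
      Tendsto (fun n : ℕ => (1 / (n : ℂ)) * ∑ i ∈ Finset.Icc 1 n, χ (x i)) atTop (𝓝 0))
    {k : ConjClasses G → ℂ} (hk : k ∈ Representation.characterSpan G) :
    Continuous k ∧ Tendsto (fun n : ℕ => (1 / (n : ℂ)) * ∑ i ∈ Finset.Icc 1 n, k (x i)) atTop
      (𝓝 (∫ g, k (ConjClasses.mk g) ∂μ)) := by
  have hint : ∀ {k : ConjClasses G → ℂ}, Continuous k →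
      Integrable (fun g => k (ConjClasses.mk g)) μ := fun hk =>
    (hk.comp ConjClasses.continuous_mk_quotient).integrable_of_compactSpace μ
  induction hk using Submodule.span_induction with
  | mem χ hχ =>
    refine ⟨hχ.continuous, ?_⟩
    by_cases h1 : χ = 1
    · subst h1
      -- At `n = 0` the average is `0`, so it equals `1` only eventually.
      refine Tendsto.congr' ?_ (tendsto_const_nhds)
      filter_upwards [eventually_ne_atTop 0] with n hn
      simp [hn]
    · rw [hχ.integral_eq_zero μ h1]
      exact hx χ hχ h1
  | zero => exact ⟨continuous_zero, by simp⟩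
  | add a b _ _ ha hb =>
    refine ⟨ha.1.add hb.1, ?_⟩
    simp only [Pi.add_apply, integral_add (hint ha.1) (hint hb.1), Finset.sum_add_distrib, mul_add]
    exact ha.2.add hb.2
  | smul c a _ ha =>
    refine ⟨ha.1.const_smul c, ?_⟩
    simp only [Pi.smul_apply, smul_eq_mul, integral_const_mul, ← Finset.mul_sum,
      mul_left_comm _ c]
    exact ha.2.const_mul c

end Equidistribution

theorem norm_average_sub_le {X : Type*} {f k : X → ℂ} {ε : ℝ} (hε : 0 ≤ ε)
    (h : ∀ x, ‖f x - k x‖ ≤ ε) (x : ℕ → X) (n : ℕ) :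
    ‖(1 / (n : ℂ)) * ∑ i ∈ Finset.Icc 1 n, f (x i) -
      (1 / (n : ℂ)) * ∑ i ∈ Finset.Icc 1 n, k (x i)‖ ≤ ε := by
  rw [← mul_sub, ← Finset.sum_sub_distrib, norm_mul]
  have hs : ‖∑ i ∈ Finset.Icc 1 n, (f (x i) - k (x i))‖ ≤ n * ε := by
    refine (norm_sum_le_of_le _ fun i _ => h (x i)).trans ?_
    simp
  rcases Nat.eq_zero_or_pos n with rfl | hn
  · simpa using hε
  · have : (0 : ℝ) < n := by exact_mod_cast hn
    rw [norm_div, norm_one, Complex.norm_natCast, one_div, inv_mul_le_iff₀ this]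
    exact hs

/-- The trivial character is the constant function `1`. -/
theorem mainTheorem4 {G : Type*} [Group G] [TopologicalSpace G] [IsTopologicalGroup G]
    [CompactSpace G] [MeasurableSpace G] [BorelSpace G]
    (μ : Measure G) [μ.IsHaarMeasure] [IsProbabilityMeasure μ] (x : ℕ → ConjClasses G) :
    IsEquidistributed (pushforwardConjClasses μ) x ↔
      ∀ χ : ConjClasses G → ℂ, IsIrreducibleCharacter χ → χ ≠ 1 →
        Tendsto (fun n : ℕ => (1 / (n : ℂ)) * ∑ i ∈ Finset.Icc 1 n, χ (x i)) atTop (𝓝 0) := by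
  refine ⟨fun h χ hχ h1 => ?_, fun h f => ?_⟩
  · have := h ⟨χ, hχ.continuous⟩
    rwa [show pushforwardConjClasses μ ⟨χ, hχ.continuous⟩ = 0 from
      hχ.integral_eq_zero μ h1] at this
  · rw [Metric.tendsto_atTop]
    intro ε hε
    -- One third of `ε` each for replacing `f` by `k` in the average, convergence for `k`, and
    -- replacing `k` by `f` in the integral.
    obtain ⟨k, hk, hfk⟩ := exists_mem_characterSpan_norm_sub_le μ f
      (show (0 : ℝ) < ε / 3 by positivity)
    obtain ⟨hkc, hkt⟩ := tendsto_average_of_mem_characterSpan μ h hk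
    obtain ⟨N, hN⟩ := Metric.tendsto_atTop.1 hkt (ε / 3) (by positivity)
    have hμ : ‖(∫ g, k (ConjClasses.mk g) ∂μ) - pushforwardConjClasses μ f‖ ≤ ε / 3 := by
      change ‖(∫ g, k (ConjClasses.mk g) ∂μ) - ∫ g, f (ConjClasses.mk g) ∂μ‖ ≤ ε / 3
      have hki : Integrable (fun g => k (ConjClasses.mk g)) μ :=
        (hkc.comp ConjClasses.continuous_mk_quotient).integrable_of_compactSpace μ
      rw [← integral_sub hki (integrable_comp_conjClasses_mk μ f)]
      refine (norm_integral_le_of_norm_le_const (C := ε / 3)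
        (Eventually.of_forall fun g => ?_)).trans (by simp)
      rw [norm_sub_rev]
      exact hfk _
    refine ⟨N, fun n hn => ?_⟩
    have h1 := norm_average_sub_le (by positivity) hfk x n
    have h2 := hN n hn
    rw [← dist_eq_norm] at h1 hμ
    calc _ ≤ _ := dist_triangle4 _ _ _ _
      _ < ε / 3 + ε / 3 + ε / 3 := add_lt_add_of_lt_of_le (add_lt_add_of_le_of_lt h1 h2) hμ
      _ = ε := by ring
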